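/- Let $0<\alpha<1$, let $x>0$, and let $y:[0,x]\to\mathbb R$ be three times continuously differentiable on $[0,x]$ (one-sided derivatives at the endpoints). Let $$y^{(\alpha)}(x)=\frac{1}{\Gamma(1-\alpha)}\int_0^x\frac{y'(\xi)}{(x-\xi)^{\alpha}}\,d\xi$$ be the Caputo derivative of $y$ of order $\alpha$ at $x$. For an integer $n\ge 2$ put $h=x/n$, so that $x=nh$, and let $$\sigma_0=1,\qquad \sigma_k=(k-1)^{1-\alpha}-2k^{1-\alpha}+(k+1)^{1-\alpha}\quad(1\le k\le n-1),\qquad \sigma_n=(n-1)^{1-\alpha}-n^{1-\alpha},$$ $$\delta_0=\sigma_0-\zeta(\alpha-1),\qquad \delta_1=\sigma_1+2\zeta(\alpha-1),\qquad \delta_2=\sigma_2-\zeta(\alpha-1),\qquad \delta_k=\sigma_k\quad(3\le k\le n),$$ where $\zeta$ is the Riemann zeta function. Then $$y^{(\alpha)}(x)=\frac{1}{\Gamma(2-\alpha)h^{\alpha}}\sum_{k=0}^{n}\delta_k\,y(x-kh)+O(h^2),$$ that is, there is a constant $C$, depending only on $\alpha$, $x$ and $y$, such that for every $n\ge 2$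 and $h=x/n$ the absolute value of the difference between $y^{(\alpha)}(x)$ and the modified L1 sum is at most $C h^2$. -/

import Mathlib

/-- The Caputo derivative of order `α` with lower limit `0`,
`y^{(α)}(x) = 1 / Γ(1 - α) * ∫₀ˣ y'(ξ) / (x - ξ)^α dξ`. -/
noncomputable def caputoDeriv (α : ℝ) (y : ℝ → ℝ) (x : ℝ) : ℝ :=
  1 / Real.Gamma (1 - α) * ∫ ξ in (0 : ℝ)..x, deriv y ξ / (x - ξ) ^ α

/-- The weights `σ_k` of the L1 scheme with `n` steps: `σ_0 = 1`,
`σ_k = (k - 1)^{1 - α} - 2 k^{1 - α} + (k + 1)^{1 - α}` for `1 ≤ k ≤ n - 1`, and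
`σ_n = (n - 1)^{1 - α} - n^{1 - α}`. -/
noncomputable def l1Weight (α : ℝ) (n k : ℕ) : ℝ :=
  if k = 0 then 1
  else if k = n then ((n : ℝ) - 1) ^ (1 - α) - (n : ℝ) ^ (1 - α)
  else ((k : ℝ) - 1) ^ (1 - α) - 2 * (k : ℝ) ^ (1 - α) + ((k : ℝ) + 1) ^ (1 - α)

/-- The value of the Riemann zeta function at a real point (it is real there). -/
noncomputable def realZeta (s : ℝ) : ℝ := (riemannZeta (s : ℂ)).re

/-- The weights `δ_k` of the modified L1 scheme with `n` steps: `δ_0 = σ_0 - ζ(α - 1)`,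
`δ_1 = σ_1 + 2 ζ(α - 1)`, `δ_2 = σ_2 - ζ(α - 1)`, and `δ_k = σ_k` for `k ≥ 3`. -/
noncomputable def modifiedL1Weight (α : ℝ) (n k : ℕ) : ℝ :=
  if k = 0 then l1Weight α n 0 - realZeta (α - 1)
  else if k = 1 then l1Weight α n 1 + 2 * realZeta (α - 1)
  else if k = 2 then l1Weight α n 2 - realZeta (α - 1)
  else l1Weight α n k

/-- The modified L1 approximation
`1 / (Γ(2 - α) h^α) * ∑_{k = 0}^n δ_k y(x - k h)`. -/
noncomputable def modifiedL1 (α : ℝ) (y : ℝ → ℝ) (x h : ℝ) (n : ℕ) : ℝ :=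
  1 / (Real.Gamma (2 - α) * h ^ α) *
    ∑ k ∈ Finset.range (n + 1), modifiedL1Weight α n k * y (x - (k : ℝ) * h)

/-!
With `u t = y (x - t)` the Caputo derivative is `-1 / Γ(1 - α)` times `∫ u' t * t ^ (-α)` over
`[0, x]`, and the plain L1 sum is the same integral with `u` replaced by its piecewise linear
interpolant on the grid `k h` (`sum_l1Weight_mul`). On the cell `[k h, k h + h]` the derivative of
`u` minus the slope of the interpolant is `u'' (k h) * (t - (k + 1/2) h) + O(h ^ 2)`, by Taylor's
formula and the Lipschitz continuity of `u''`. The remainder contributes `O(h ^ 2)` because the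
kernel is integrable, so up to this order the error of the plain L1 sum is
`h ^ (2 - α) / (1 - α) * ∑ u'' (k h) * kernelMoment α k`, where `kernelMoment α k` is the normalized
moment of the kernel over `[k, k + 1]` (`abs_integral_sub_sum_le`).

The moments are trapezoidal errors for `t ^ (1 - α)`, hence `O(k ^ (-α - 1))`, and by the
Euler–Maclaurin formula for the zeta function they sum to `ζ(α - 1)` (`hasSum_kernelMoment`). Thus
replacing `u'' (k h)` by `u'' 0` and the finite sum by the whole series costs only `O(h ^ α)` in the
sum (`abs_sum_mul_kernelMoment_sub_le`), and the leading error is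
`h ^ (2 - α) * u'' 0 * ζ(α - 1) / (1 - α)`. The modified weights cancel it, because they subtract
`ζ(α - 1)` times the second difference `u 0 - 2 u h + u (2 h) = h ^ 2 * u'' 0 + O(h ^ 3)`.

The value `ζ(α - 1)` lies outside the domain of the Dirichlet series. For `1 < Re s` the partial
sums of the trapezoidal errors of `t ^ (-s)` telescope and give `ζ(s)`. The errors are of the size
of the second derivative of `t ^ (-s)`, so their series converges locally uniformly on `-1 < Re s`,
and the formula extends by the identity theorem (`hasSum_zetaTrapezoidError`).
-/

/-! ### The Euler–Maclaurin formula for `ζ` on the half-plane `-1 < Re s` -/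

/-- `(s - 1)` times the error of the trapezoidal rule for `∫ t ^ (-s)` over `[k + 1, k + 2]`. The
factor `s - 1` makes the integral `((k + 2) ^ (1 - s) - (k + 1) ^ (1 - s)) / (1 - s)` an entire
function of `s`. -/
noncomputable def zetaTrapezoidError (k : ℕ) (s : ℂ) : ℂ :=
  (s - 1) * ((((k : ℝ) + 1 : ℝ) : ℂ) ^ (-s) + (((k : ℝ) + 2 : ℝ) : ℂ) ^ (-s)) / 2 +
    ((((k : ℝ) + 2 : ℝ) : ℂ) ^ (1 - s) - (((k : ℝ) + 1 : ℝ) : ℂ) ^ (1 - s))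

lemma hasDerivAt_ofReal_cpow_of_pos {t : ℝ} (ht : 0 < t) (c : ℂ) :
    HasDerivAt (fun y : ℝ => (y : ℂ) ^ c) (c * (t : ℂ) ^ (c - 1)) t := by
  have h : HasDerivAt (fun z : ℂ => z ^ c) (c * (t : ℂ) ^ (c - 1) * 1) (t : ℂ) :=
    (hasDerivAt_id (t : ℂ)).cpow_const (Or.inl (by simpa using ht))
  simpa using h.comp_ofReal

/-- The mean value inequality applied twice, on an interval of length one at whose left endpoint
`f` and `f'` vanish. -/
lemma norm_le_of_norm_second_deriv_le {f f' f'' : ℝ → ℂ} {a B : ℝ}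
    (hf : ∀ t ∈ Set.Icc a (a + 1), HasDerivAt f (f' t) t)
    (hf' : ∀ t ∈ Set.Icc a (a + 1), HasDerivAt f' (f'' t) t)
    (h0 : f a = 0) (h0' : f' a = 0) (hB : 0 ≤ B)
    (hB' : ∀ t ∈ Set.Icc a (a + 1), ‖f'' t‖ ≤ B) : ‖f (a + 1)‖ ≤ B := by
  have h1 : ∀ t ∈ Set.Icc a (a + 1), ‖f' t‖ ≤ B := by
    intro t ht
    have := norm_image_sub_le_of_norm_deriv_le_segment'
      (fun u hu => (hf' u hu).hasDerivWithinAt)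
      (fun u hu => hB' u (Set.Ico_subset_Icc_self hu)) t ht
    rw [h0', sub_zero] at this
    refine this.trans ?_
    nlinarith [ht.1, ht.2]
  have := norm_image_sub_le_of_norm_deriv_le_segment'
    (fun u hu => (hf u hu).hasDerivWithinAt)
    (fun u hu => h1 u (Set.Ico_subset_Icc_self hu)) (a + 1)
    (Set.right_mem_Icc.2 (by linarith))
  simpa [h0] using this

/-- The trapezoidal rule on `[k + 1, k + 2]` has an error of the size of the second derivative
`s (s + 1) t ^ (-s - 2)`. -/
lemma norm_zetaTrapezoidError_le (k : ℕ) {s : ℂ} (hs : -1 ≤ s.re) :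
    ‖zetaTrapezoidError k s‖ ≤ ‖(s - 1) * s * (s + 1)‖ * ((k : ℝ) + 1) ^ (-s.re - 2) := by
  set a : ℝ := (k : ℝ) + 1 with ha
  have ha0 : 0 < a := by positivity
  have e : ((k : ℝ) + 2 : ℝ) = a + 1 := by rw [ha]; ring
  set f : ℝ → ℂ := fun t => (s - 1) * (((t - a : ℝ) : ℂ) * ((a : ℂ) ^ (-s) + (t : ℂ) ^ (-s))) / 2 +
    ((t : ℂ) ^ (1 - s) - (a : ℂ) ^ (1 - s)) with hf
  set f' : ℝ → ℂ := fun t => (s - 1) / 2 * ((a : ℂ) ^ (-s) - (t : ℂ) ^ (-s) -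
    s * (((t - a : ℝ) : ℂ) * (t : ℂ) ^ (-s - 1))) with hf'
  have hlin : ∀ t : ℝ, HasDerivAt (fun t : ℝ => ((t - a : ℝ) : ℂ)) 1 t := by
    intro t
    simpa using ((hasDerivAt_id t).sub_const a).ofReal_comp
  have key := norm_le_of_norm_second_deriv_le (f := f) (f' := f')
    (f'' := fun t => (s - 1) * s * (s + 1) / 2 * (((t - a : ℝ) : ℂ) * (t : ℂ) ^ (-s - 2)))
    (a := a) (B := ‖(s - 1) * s * (s + 1)‖ * a ^ (-s.re - 2)) ?_ ?_ ?_ ?_ ?_ ?_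
  · have : zetaTrapezoidError k s = f (a + 1) := by
      simp only [zetaTrapezoidError, hf, e, ← ha]
      simp
    rw [this]; exact key
  · intro t ht
    have ht0 : 0 < t := lt_of_lt_of_le ha0 ht.1
    have := (((((hlin t).mul ((hasDerivAt_ofReal_cpow_of_pos ht0 (-s)).const_add
      ((a : ℂ) ^ (-s)))).const_mul (s - 1)).div_const 2)).add
      ((hasDerivAt_ofReal_cpow_of_pos ht0 (1 - s)).sub_const ((a : ℂ) ^ (1 - s)))
    convert! this using 1
    simp only [hf']
    have h2 : (1 - s - 1 : ℂ) = -s := by ring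
    rw [h2]; ring
  · intro t ht
    have ht0 : 0 < t := lt_of_lt_of_le ha0 ht.1
    have := ((((hasDerivAt_ofReal_cpow_of_pos ht0 (-s)).const_sub ((a : ℂ) ^ (-s)))).sub
      (((hlin t).mul (hasDerivAt_ofReal_cpow_of_pos ht0 (-s - 1))).const_mul s)).const_mul
      ((s - 1) / 2)
    convert! this using 1
    have h2 : (-s - 1 - 1 : ℂ) = -s - 2 := by ring
    rw [h2]; ring
  · simp [hf]
  · simp [hf']
  · positivity
  · intro t ht
    have ht0 : 0 < t := lt_of_lt_of_le ha0 ht.1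
    rw [norm_mul, norm_mul, norm_div, Complex.norm_cpow_eq_rpow_re_of_pos ht0, Complex.norm_real,
      Real.norm_of_nonneg (by linarith [ht.1])]
    have h1 : t ^ (-s - 2 : ℂ).re ≤ a ^ (-s.re - 2) := by
      simp only [Complex.sub_re, Complex.neg_re, Complex.re_ofNat]
      exact Real.rpow_le_rpow_of_nonpos ha0 ht.1 (by linarith)
    have h2 : (t - a) * t ^ (-s - 2 : ℂ).re ≤ 1 * a ^ (-s.re - 2) :=
      mul_le_mul (by linarith [ht.2]) h1 (by positivity) zero_le_one
    rw [one_mul] at h2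
    have h3 : ‖(s - 1) * s * (s + 1)‖ / ‖(2 : ℂ)‖ ≤ ‖(s - 1) * s * (s + 1)‖ := by
      rw [Complex.norm_ofNat]
      exact half_le_self (norm_nonneg _)
    exact mul_le_mul h3 h2 (mul_nonneg (by linarith [ht.1]) (by positivity)) (norm_nonneg _)

lemma differentiable_zetaTrapezoidError (k : ℕ) : Differentiable ℂ (zetaTrapezoidError k) := by
  have h1 : (((k : ℝ) + 1 : ℝ) : ℂ) ≠ 0 := by
    exact_mod_cast (by positivity : (k : ℝ) + 1 ≠ 0)
  have h2 : (((k : ℝ) + 2 : ℝ) : ℂ) ≠ 0 := by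
    exact_mod_cast (by positivity : (k : ℝ) + 2 ≠ 0)
  have hc : ∀ {c : ℂ}, c ≠ 0 → Differentiable ℂ (fun s : ℂ => c ^ (-s)) := fun hc s =>
    (differentiableAt_id.neg).const_cpow (Or.inl hc)
  have hc' : ∀ {c : ℂ}, c ≠ 0 → Differentiable ℂ (fun s : ℂ => c ^ (1 - s)) := fun hc s =>
    (differentiableAt_id.const_sub 1).const_cpow (Or.inl hc)
  unfold zetaTrapezoidError
  exact ((((differentiable_id.sub_const 1).mul ((hc h1).add (hc h2))).div_const 2)).add
    ((hc' h2).sub (hc' h1))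

lemma sum_zetaTrapezoidError (N : ℕ) (s : ℂ) :
    ∑ k ∈ Finset.range N, zetaTrapezoidError k s =
      (s - 1) * ((∑ k ∈ Finset.range N, 1 / ((k : ℂ) + 1) ^ s) - 1 / 2 +
        (((N : ℝ) + 1 : ℝ) : ℂ) ^ (-s) / 2) + (((N : ℝ) + 1 : ℝ) : ℂ) ^ (1 - s) - 1 := by
  induction N with
  | zero => simp
  | succ N ih =>
    rw [Finset.sum_range_succ, Finset.sum_range_succ, ih, zetaTrapezoidError]
    have e : (((N + 1 : ℕ) : ℝ) + 1 : ℝ) = (N : ℝ) + 2 := by push_cast; ring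
    have e2 : 1 / ((N : ℂ) + 1) ^ s = (((N : ℝ) + 1 : ℝ) : ℂ) ^ (-s) := by
      rw [Complex.cpow_neg, one_div]; push_cast; rfl
    rw [e, e2]
    ring

lemma tendsto_add_one_cpow_zero {c : ℂ} (hc : c.re < 0) :
    Filter.Tendsto (fun N : ℕ => (((N : ℝ) + 1 : ℝ) : ℂ) ^ c) Filter.atTop (nhds 0) := by
  rw [tendsto_zero_iff_norm_tendsto_zero]
  have h : ∀ N : ℕ, ‖(((N : ℝ) + 1 : ℝ) : ℂ) ^ c‖ = ((N : ℝ) + 1) ^ (-(-c.re)) := fun N => by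
    rw [Complex.norm_cpow_eq_rpow_re_of_pos (by positivity), neg_neg]
  simp only [h]
  exact (tendsto_rpow_neg_atTop (by linarith)).comp
    (Filter.tendsto_atTop_add_const_right _ _ tendsto_natCast_atTop_atTop)

lemma tsum_zetaTrapezoidError_of_one_lt_re {s : ℂ} (hs : 1 < s.re) :
    ∑' k, zetaTrapezoidError k s = (s - 1) * (riemannZeta s - 1 / 2) - 1 := by
  have hsum : Summable fun k => zetaTrapezoidError k s := by
    refine Summable.of_norm_bounded ?_ fun k => norm_zetaTrapezoidError_le k (by linarith)
    refine Summable.mul_left _ ?_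
    have := (summable_nat_add_iff 1).2 (Real.summable_nat_rpow (p := -s.re - 2).2 (by linarith))
    simpa using this
  have hz : Filter.Tendsto (fun N => ∑ k ∈ Finset.range N, 1 / ((k : ℂ) + 1) ^ s) Filter.atTop
      (nhds (riemannZeta s)) := by
    rw [zeta_eq_tsum_one_div_nat_add_one_cpow hs]
    have := (summable_nat_add_iff 1).2 (Complex.summable_one_div_nat_cpow.2 hs)
    exact (by simpa using this : Summable fun k : ℕ => 1 / ((k : ℂ) + 1) ^ s).hasSum.tendsto_sum_nat
  refine tendsto_nhds_unique hsum.hasSum.tendsto_sum_nat ?_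
  simp only [sum_zetaTrapezoidError]
  have h1 := tendsto_add_one_cpow_zero (c := -s) (by simp; linarith)
  have h2 := tendsto_add_one_cpow_zero (c := 1 - s) (by simp; linarith)
  have := (((hz.sub_const (1 / 2)).add (h1.div_const 2)).const_mul (s - 1)).add h2 |>.sub_const 1
  simpa using this

/-- The series of trapezoidal errors converges on `-1 < Re s`, and continues the formula that holds
for `1 < Re s`. The point is restricted to the disc `|s - 2| < 3`, which contains the real interval
`(-1, 1)`, so that the series is dominated uniformly on a smaller concentric disc. -/
lemma hasSum_zetaTrapezoidError {s : ℂ} (hs : ‖s - 2‖ < 3) (hs1 : s ≠ 1) :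
    HasSum (fun k => zetaTrapezoidError k s) ((s - 1) * (riemannZeta s - 1 / 2) - 1) := by
  obtain ⟨r, hr, hr3⟩ := exists_between hs
  set U : Set ℂ := Metric.ball 2 r with hU
  have hUo : IsOpen U := Metric.isOpen_ball
  have hr0 : 0 < r := lt_of_le_of_lt (norm_nonneg _) hr
  have hre : ∀ w ∈ U, 2 - r < w.re ∧ ‖w‖ ≤ 5 := by
    intro w hw
    rw [hU, mem_ball_iff_norm] at hw
    have h1 := (abs_le.1 (Complex.abs_re_le_norm (w - 2))).1
    have h2 : ‖w‖ ≤ ‖w - 2‖ + ‖(2 : ℂ)‖ := by simpa using norm_add_le (w - 2) 2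
    rw [Complex.norm_ofNat] at h2
    simp only [Complex.sub_re, Complex.re_ofNat] at h1
    constructor <;> linarith
  have hbound : ∀ k : ℕ, ∀ w ∈ U, ‖zetaTrapezoidError k w‖ ≤ 6 * 5 * 6 * ((k : ℝ) + 1) ^ (r - 4) := by
    intro k w hw
    obtain ⟨h1, h2⟩ := hre w hw
    refine (norm_zetaTrapezoidError_le k (by linarith)).trans ?_
    have h3 : ‖w - 1‖ ≤ 6 := (norm_sub_le _ _).trans (by rw [norm_one]; linarith)
    have h4 : ‖w + 1‖ ≤ 6 := (norm_add_le _ _).trans (by rw [norm_one]; linarith)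
    rw [norm_mul, norm_mul]
    have h5 : ((k : ℝ) + 1) ^ (-w.re - 2) ≤ ((k : ℝ) + 1) ^ (r - 4) :=
      Real.rpow_le_rpow_of_exponent_le (by linarith [Nat.cast_nonneg (α := ℝ) k]) (by linarith)
    gcongr
  have hsumb : Summable fun k : ℕ => 6 * 5 * 6 * ((k : ℝ) + 1) ^ (r - 4) := by
    refine Summable.mul_left _ ?_
    have := (summable_nat_add_iff 1).2 (Real.summable_nat_rpow (p := r - 4).2 (by linarith))
    simpa using this
  have hsU : s ∈ U := by rw [hU, mem_ball_iff_norm]; exact hr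
  have hsum : Summable fun k => zetaTrapezoidError k s :=
    Summable.of_norm_bounded hsumb fun k => hbound k s hsU
  have hd : DifferentiableOn ℂ (fun w => ∑' k, zetaTrapezoidError k w) U :=
    Complex.differentiableOn_tsum_of_summable_norm hsumb
      (fun k => (differentiable_zetaTrapezoidError k).differentiableOn) hUo hbound
  have hd' : Differentiable ℂ (fun w : ℂ => riemannZeta₁ w - (w - 1) * (1 / 2) - 1) :=
    (differentiable_riemannZeta₁.sub ((differentiable_id.sub_const 1).mul_const _)).sub_const 1
  have hζ : ∀ w : ℂ, w ≠ 1 →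
      riemannZeta₁ w - (w - 1) * (1 / 2) - 1 = (w - 1) * (riemannZeta w - 1 / 2) - 1 := by
    intro w hw
    have : w - 1 ≠ 0 := sub_ne_zero.2 hw
    rw [riemannZeta_eq_inv_sub_mul hw]
    field_simp
  have hev : (fun w => ∑' k, zetaTrapezoidError k w) =ᶠ[nhds 2]
      fun w : ℂ => riemannZeta₁ w - (w - 1) * (1 / 2) - 1 := by
    have : {w : ℂ | 1 < w.re} ∈ nhds (2 : ℂ) :=
      (isOpen_lt continuous_const Complex.continuous_re).mem_nhds (by simp)
    filter_upwards [this] with w hw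
    have hw' : (1 : ℝ) < w.re := hw
    rw [tsum_zetaTrapezoidError_of_one_lt_re hw', hζ w]
    rintro rfl
    simp at hw'
  have := AnalyticOnNhd.eqOn_of_preconnected_of_eventuallyEq (hd.analyticOnNhd hUo)
    (hd'.differentiableOn.analyticOnNhd hUo) (convex_ball _ _).isPreconnected
    (Metric.mem_ball_self hr0) hev hsU
  simp only at this
  rw [← hζ s hs1, ← this]
  exact hsum.hasSum

/-! ### The normalized cell moments of the kernel and their sum `ζ(α - 1)` -/

/-- `1 - α` times the moment `∫ (t - (k + 1/2)) t ^ (-α)` over `[k, k + 1]`, in closed form. It is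
also the error of the trapezoidal rule for `∫ t ^ (1 - α)` over the same interval. -/
noncomputable def kernelMoment (α : ℝ) (k : ℕ) : ℝ :=
  (((k : ℝ) + 1) ^ (1 - α) + (k : ℝ) ^ (1 - α)) / 2 -
    (((k : ℝ) + 1) ^ (2 - α) - (k : ℝ) ^ (2 - α)) / (2 - α)

lemma kernelMoment_zero {α : ℝ} (hα : α < 1) : kernelMoment α 0 = 1 / 2 - 1 / (2 - α) := by
  simp [kernelMoment, Real.zero_rpow (by linarith : (1 - α) ≠ 0),
    Real.zero_rpow (by linarith : (2 - α) ≠ 0)]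

lemma zetaTrapezoidError_eq_kernelMoment {α : ℝ} (hα : α < 1) (k : ℕ) :
    zetaTrapezoidError k ((α - 1 : ℝ) : ℂ) = (((α - 2) * kernelMoment α (k + 1) : ℝ) : ℂ) := by
  have h1 : (0 : ℝ) ≤ (k : ℝ) + 1 := by positivity
  have h2 : (0 : ℝ) ≤ (k : ℝ) + 2 := by positivity
  have e1 : -(((α - 1 : ℝ)) : ℂ) = ((1 - α : ℝ) : ℂ) := by push_cast; ring
  have e2 : 1 - (((α - 1 : ℝ)) : ℂ) = ((2 - α : ℝ) : ℂ) := by push_cast; ring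
  rw [zetaTrapezoidError, e1, e2, ← Complex.ofReal_cpow h1, ← Complex.ofReal_cpow h2,
    ← Complex.ofReal_cpow h1, ← Complex.ofReal_cpow h2, kernelMoment]
  have e3 : (((k + 1 : ℕ) : ℝ) + 1) = (k : ℝ) + 2 := by push_cast; ring
  rw [e3]
  have e4 : (α - 2) * (((((k : ℝ) + 2) ^ (1 - α) + ((k + 1 : ℕ) : ℝ) ^ (1 - α)) / 2) -
      (((k : ℝ) + 2) ^ (2 - α) - ((k + 1 : ℕ) : ℝ) ^ (2 - α)) / (2 - α)) =
      (α - 1 - 1) * (((k : ℝ) + 1) ^ (1 - α) + ((k : ℝ) + 2) ^ (1 - α)) / 2 +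
        (((k : ℝ) + 2) ^ (2 - α) - ((k : ℝ) + 1) ^ (2 - α)) := by
    have : (2 - α) ≠ 0 := by linarith
    push_cast
    field_simp
    ring
  rw [e4]
  push_cast
  rfl

lemma hasSum_kernelMoment {α : ℝ} (hα0 : 0 < α) (hα1 : α < 1) :
    HasSum (kernelMoment α) (realZeta (α - 1)) := by
  have hs : ‖((α - 1 : ℝ) : ℂ) - 2‖ < 3 := by
    have : ((α - 1 : ℝ) : ℂ) - 2 = ((α - 3 : ℝ) : ℂ) := by push_cast; ring
    rw [this, Complex.norm_real, Real.norm_eq_abs, abs_lt]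
    constructor <;> linarith
  have hs1 : ((α - 1 : ℝ) : ℂ) ≠ 1 := by
    intro h
    have : α - 1 = 1 := by exact_mod_cast h
    linarith
  have h := Complex.hasSum_re (hasSum_zetaTrapezoidError hs hs1)
  have e : ((((α - 1 : ℝ) : ℂ) - 1) * (riemannZeta ((α - 1 : ℝ) : ℂ) - 1 / 2) - 1).re =
      (α - 2) * (realZeta (α - 1) - 1 / 2) - 1 := by
    have : (((α - 1 : ℝ) : ℂ) - 1) = ((α - 2 : ℝ) : ℂ) := by push_cast; ring
    rw [this, Complex.sub_re, Complex.re_ofReal_mul, Complex.sub_re, realZeta]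
    norm_num
  rw [e] at h
  simp only [zetaTrapezoidError_eq_kernelMoment hα1, Complex.ofReal_re] at h
  have h2 := h.mul_left (α - 2)⁻¹
  have h3 : α - 2 ≠ 0 := by linarith
  have h4 : 2 - α ≠ 0 := by linarith
  simp only [inv_mul_cancel_left₀ h3] at h2
  have e' : (α - 2)⁻¹ * ((α - 2) * (realZeta (α - 1) - 1 / 2) - 1) =
      realZeta (α - 1) - ∑ k ∈ Finset.range 1, kernelMoment α k := by
    rw [Finset.sum_range_one, kernelMoment_zero hα1, mul_sub, inv_mul_cancel_left₀ h3,
      show α - 2 = -(2 - α) by ring, inv_neg]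
    field_simp
    ring
  rw [e'] at h2
  exact (hasSum_nat_add_iff' 1).1 h2

lemma abs_kernelMoment_succ_le {α : ℝ} (hα0 : 0 < α) (hα1 : α < 1) (k : ℕ) :
    |kernelMoment α (k + 1)| ≤ ((k : ℝ) + 1) ^ (-α - 1) := by
  have h := norm_zetaTrapezoidError_le k (s := ((α - 1 : ℝ) : ℂ)) (by simp; linarith)
  have e : (((α - 1 : ℝ) : ℂ) - 1) * ((α - 1 : ℝ) : ℂ) * (((α - 1 : ℝ) : ℂ) + 1) =
      (((α - 2) * (α - 1) * α : ℝ) : ℂ) := by push_cast; ring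
  rw [zetaTrapezoidError_eq_kernelMoment hα1, e, Complex.norm_real, Complex.norm_real,
    Complex.ofReal_re, Real.norm_eq_abs, Real.norm_eq_abs, abs_mul, abs_mul, abs_mul, mul_assoc,
    mul_assoc] at h
  have h2 : 0 < |α - 2| := abs_pos.2 (by linarith)
  have h3 := le_of_mul_le_mul_left h h2
  rw [show -(α - 1) - 2 = -α - 1 by ring, abs_of_pos hα0, abs_of_neg (by linarith : α - 1 < 0)]
    at h3
  refine h3.trans ?_
  have h4 : 0 < ((k : ℝ) + 1) ^ (-α - 1) := by positivity
  rw [← mul_assoc]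
  exact mul_le_of_le_one_left h4.le (by nlinarith)

/-- Comparison of `(t + 1) ^ (p - 1)` with the increment of its primitive `t ^ p / p`, for a
positive or a negative exponent `p < 1`. -/
lemma add_one_rpow_le_sub_div {t p : ℝ} (ht : 0 ≤ t) (hp : p < 1) (hp0 : p ≠ 0)
    (h : 0 < t ∨ 0 < p) : (t + 1) ^ (p - 1) ≤ ((t + 1) ^ p - t ^ p) / p := by
  obtain ⟨c, hc, hc'⟩ := exists_hasDerivAt_eq_slope (fun u : ℝ => u ^ p)
    (fun u => p * u ^ (p - 1)) (lt_add_one t)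
    (fun u hu => (Real.continuousAt_rpow_const u p
      (h.imp (fun h => (lt_of_lt_of_le h hu.1).ne') (fun h => h.le))).continuousWithinAt)
    (fun u hu => Real.hasDerivAt_rpow_const (Or.inl (lt_of_le_of_lt ht hu.1).ne'))
  rw [add_sub_cancel_left, div_one] at hc'
  rw [← hc', mul_div_cancel_left₀ _ hp0]
  exact Real.rpow_le_rpow_of_nonpos (lt_of_le_of_lt ht hc.1) hc.2.le (by linarith)

lemma sum_add_one_rpow_neg_le {α : ℝ} (hα0 : 0 < α) (hα1 : α < 1) (m : ℕ) :
    ∑ k ∈ Finset.range m, ((k : ℝ) + 1) ^ (-α) ≤ (m : ℝ) ^ (1 - α) / (1 - α) := by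
  induction m with
  | zero => simp [Real.zero_rpow (by linarith : 1 - α ≠ 0)]
  | succ m ih =>
    rw [Finset.sum_range_succ]
    have := add_one_rpow_le_sub_div (t := m) (p := 1 - α) (by positivity) (by linarith)
      (by linarith) (Or.inr (by linarith))
    rw [show 1 - α - 1 = -α by ring, sub_div] at this
    push_cast
    linarith

lemma abs_kernelMoment_succ_le_sub {α : ℝ} (hα0 : 0 < α) (hα1 : α < 1) (k : ℕ) :
    |kernelMoment α (k + 1)| ≤ 4 / α * (((k : ℝ) + 1) ^ (-α) - ((k : ℝ) + 2) ^ (-α)) := by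
  have h1 := add_one_rpow_le_sub_div (t := (k : ℝ) + 1) (p := -α) (by positivity) (by linarith)
    (by linarith) (Or.inl (by positivity))
  rw [show (k : ℝ) + 1 + 1 = k + 2 by ring, div_neg, ← neg_div, neg_sub] at h1
  have h2 : ((k : ℝ) + 1) ^ (-α - 1) ≤ 4 * ((k : ℝ) + 2) ^ (-α - 1) := by
    have : (2 * ((k : ℝ) + 1)) ^ (-α - 1) ≤ ((k : ℝ) + 2) ^ (-α - 1) :=
      Real.rpow_le_rpow_of_nonpos (by positivity)
        (by linarith [Nat.cast_nonneg (α := ℝ) k]) (by linarith)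
    rw [Real.mul_rpow (by norm_num) (by positivity)] at this
    have h3 : (1 / 4 : ℝ) ≤ 2 ^ (-α - 1) := by
      have : (2 : ℝ) ^ (-2 : ℝ) ≤ 2 ^ (-α - 1) :=
        Real.rpow_le_rpow_of_exponent_le (by norm_num) (by linarith)
      refine le_trans (le_of_eq ?_) this
      rw [Real.rpow_neg (by norm_num)]
      norm_num
    have h4 : 0 < ((k : ℝ) + 1) ^ (-α - 1) := by positivity
    nlinarith
  refine (abs_kernelMoment_succ_le hα0 hα1 k).trans (h2.trans ?_)
  rw [div_mul_eq_mul_div, mul_div_assoc]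
  gcongr

/-- The tail of the series `∑ kernelMoment α k = ζ(α - 1)` is `O(n ^ (-α))`. -/
lemma abs_sum_kernelMoment_sub_le {α : ℝ} (hα0 : 0 < α) (hα1 : α < 1) {n : ℕ} (hn : 1 ≤ n) :
    |∑ k ∈ Finset.range n, kernelMoment α k - realZeta (α - 1)| ≤ 4 / α * (n : ℝ) ^ (-α) := by
  have hpart : ∀ m : ℕ, |∑ k ∈ Finset.range n, kernelMoment α k -
      ∑ k ∈ Finset.range (m + n), kernelMoment α k| ≤
      4 / α * ((n : ℝ) ^ (-α) - ((m + n : ℕ) : ℝ) ^ (-α)) := by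
    intro m
    induction m with
    | zero => simp
    | succ m ih =>
      obtain ⟨j, rfl⟩ : ∃ j, n = j + 1 := ⟨n - 1, by omega⟩
      have e : m + 1 + (j + 1) = (m + (j + 1)) + 1 := by ring
      rw [e, Finset.sum_range_succ _ (m + (j + 1))]
      have h := abs_kernelMoment_succ_le_sub hα0 hα1 (m + j)
      have h2 := abs_sub (∑ k ∈ Finset.range (j + 1), kernelMoment α k -
        ∑ k ∈ Finset.range (m + (j + 1)), kernelMoment α k) (kernelMoment α (m + j + 1))
      have e1 : (((m + j : ℕ) : ℝ) + 1) = ((m + (j + 1) : ℕ) : ℝ) := by push_cast; ring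
      have e2 : (((m + j : ℕ) : ℝ) + 2) = ((m + (j + 1) + 1 : ℕ) : ℝ) := by push_cast; ring
      rw [e1, e2] at h
      rw [← sub_sub]
      rw [mul_sub] at h ih ⊢
      rw [add_assoc m j 1] at h2 h
      linarith
  have ht := (((hasSum_kernelMoment hα0 hα1).tendsto_sum_nat.comp
    (Filter.tendsto_add_atTop_nat n)).const_sub (∑ k ∈ Finset.range n, kernelMoment α k)).abs
  refine le_of_tendsto ht (Filter.Eventually.of_forall fun m => (hpart m).trans ?_)
  have : 0 ≤ ((m + n : ℕ) : ℝ) ^ (-α) := by positivity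
  have : 0 < 4 / α := by positivity
  exact mul_le_mul_of_nonneg_left (by linarith) this.le

/-! ### Summation by parts for the weights -/

lemma sum_l1Weight_mul_of_lt {α : ℝ} (hα : α < 1) {n m : ℕ} (hm : m < n) (a : ℕ → ℝ) :
    ∑ k ∈ Finset.range (m + 1), l1Weight α n k * a k =
      a m * (((m : ℝ) + 1) ^ (1 - α) - (m : ℝ) ^ (1 - α)) -
      ∑ k ∈ Finset.range m, (a (k + 1) - a k) * (((k : ℝ) + 1) ^ (1 - α) - (k : ℝ) ^ (1 - α)) := by
  induction m with
  | zero => simp [l1Weight, Real.zero_rpow (by linarith : 1 - α ≠ 0)]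
  | succ m ih =>
    rw [Finset.sum_range_succ, ih (by omega), Finset.sum_range_succ, l1Weight,
      if_neg (Nat.succ_ne_zero m), if_neg hm.ne]
    push_cast
    rw [add_sub_cancel_right]
    ring

/-- The L1 sum is the sum of the increments of the function against those of `t ^ (1 - α)`, that
is, the fractional integral of the derivative of the piecewise linear interpolant. -/
lemma sum_l1Weight_mul {α : ℝ} (hα : α < 1) {n : ℕ} (hn : 1 ≤ n) (a : ℕ → ℝ) :
    ∑ k ∈ Finset.range (n + 1), l1Weight α n k * a k =
      -∑ k ∈ Finset.range n, (a (k + 1) - a k) *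
        (((k : ℝ) + 1) ^ (1 - α) - (k : ℝ) ^ (1 - α)) := by
  obtain ⟨m, rfl⟩ : ∃ m, n = m + 1 := ⟨n - 1, by omega⟩
  rw [Finset.sum_range_succ, sum_l1Weight_mul_of_lt hα (Nat.lt_succ_self m),
    Finset.sum_range_succ _ m, l1Weight, if_neg (Nat.succ_ne_zero m), if_pos rfl]
  push_cast
  rw [add_sub_cancel_right]
  ring

lemma sum_modifiedL1Weight_mul {α : ℝ} (hα : α < 1) {n : ℕ} (hn : 2 ≤ n) (a : ℕ → ℝ) :
    ∑ k ∈ Finset.range (n + 1), modifiedL1Weight α n k * a k =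
      -(∑ k ∈ Finset.range n, (a (k + 1) - a k) *
        (((k : ℝ) + 1) ^ (1 - α) - (k : ℝ) ^ (1 - α)) +
        realZeta (α - 1) * (a 0 - 2 * a 1 + a 2)) := by
  rw [neg_add, ← sum_l1Weight_mul hα (by omega)]
  obtain ⟨m, rfl⟩ : ∃ m, n = m + 2 := ⟨n - 2, by omega⟩
  rw [Finset.sum_range_succ', Finset.sum_range_succ', Finset.sum_range_succ',
    Finset.sum_range_succ' _ (m + 2), Finset.sum_range_succ' _ (m + 1),
    Finset.sum_range_succ' _ m]
  simp only [modifiedL1Weight]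
  simp
  ring

/-! ### Taylor estimates on a cell -/

section Taylor

variable {u u₁ u₂ : ℝ → ℝ} {x M : ℝ}

lemma abs_taylor_one_le
    (hu₁ : ∀ t ∈ Set.Icc 0 x, HasDerivWithinAt u₁ (u₂ t) (Set.Icc 0 x) t) (hM : 0 ≤ M)
    (hL : ∀ a ∈ Set.Icc 0 x, ∀ b ∈ Set.Icc 0 x, |u₂ b - u₂ a| ≤ M * |b - a|)
    {a t : ℝ} (ha : 0 ≤ a) (hat : a ≤ t) (ht : t ≤ x) :
    |u₁ t - u₁ a - u₂ a * (t - a)| ≤ M * (t - a) ^ 2 := by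
  have hsub : Set.Icc a t ⊆ Set.Icc 0 x := Set.Icc_subset_Icc ha ht
  have h := norm_image_sub_le_of_norm_deriv_le_segment' (f := fun s => u₁ s - u₂ a * (s - a))
    (f' := fun s => u₂ s - u₂ a) (a := a) (b := t) (C := M * (t - a)) ?_ ?_ t
    (Set.right_mem_Icc.2 hat)
  · rw [Real.norm_eq_abs] at h
    convert h using 1
    · congr 1; ring
    · ring
  · intro s hs
    have := ((hu₁ s (hsub hs)).mono hsub).sub
      ((((hasDerivAt_id s).sub_const a).const_mul (u₂ a)).hasDerivWithinAt)
    convert! this using 1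
    simp
  · intro s hs
    rw [Real.norm_eq_abs]
    refine (hL a (hsub (Set.left_mem_Icc.2 hat)) s (hsub (Set.Ico_subset_Icc_self hs))).trans ?_
    rw [abs_of_nonneg (by linarith [hs.1])]
    exact mul_le_mul_of_nonneg_left (by linarith [hs.2]) hM

lemma abs_taylor_two_le
    (hu : ∀ t ∈ Set.Icc 0 x, HasDerivWithinAt u (u₁ t) (Set.Icc 0 x) t)
    (hu₁ : ∀ t ∈ Set.Icc 0 x, HasDerivWithinAt u₁ (u₂ t) (Set.Icc 0 x) t) (hM : 0 ≤ M)
    (hL : ∀ a ∈ Set.Icc 0 x, ∀ b ∈ Set.Icc 0 x, |u₂ b - u₂ a| ≤ M * |b - a|)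
    {a t : ℝ} (ha : 0 ≤ a) (hat : a ≤ t) (ht : t ≤ x) :
    |u t - u a - u₁ a * (t - a) - u₂ a * (t - a) ^ 2 / 2| ≤ M * (t - a) ^ 3 := by
  have hsub : Set.Icc a t ⊆ Set.Icc 0 x := Set.Icc_subset_Icc ha ht
  have h := norm_image_sub_le_of_norm_deriv_le_segment'
    (f := fun s => u s - (u₁ a * (s - a) + u₂ a / 2 * (s - a) ^ 2))
    (f' := fun s => u₁ s - (u₁ a + u₂ a * (s - a))) (a := a) (b := t)
    (C := M * (t - a) ^ 2) ?_ ?_ t (Set.right_mem_Icc.2 hat)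
  · rw [Real.norm_eq_abs] at h
    convert h using 1
    · congr 1; ring
    · ring
  · intro s hs
    have h1 := (hasDerivAt_id s).sub_const a
    have := ((hu s (hsub hs)).mono hsub).sub
      (((h1.const_mul (u₁ a)).add ((h1.pow 2).const_mul (u₂ a / 2))).hasDerivWithinAt)
    convert! this using 1
    simp
    ring
  · intro s hs
    rw [Real.norm_eq_abs, ← sub_sub]
    refine (abs_taylor_one_le hu₁ hM hL ha hs.1 (hs.2.le.trans ht)).trans ?_
    exact mul_le_mul_of_nonneg_left (pow_le_pow_left₀ (by linarith [hs.1]) (by linarith [hs.2]) 2) hM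

/-- On a cell, the derivative of `u` differs from that of the linear interpolant by a multiple of
the deviation from the midpoint, up to second order. -/
lemma abs_deriv_sub_slope_sub_le
    (hu : ∀ t ∈ Set.Icc 0 x, HasDerivWithinAt u (u₁ t) (Set.Icc 0 x) t)
    (hu₁ : ∀ t ∈ Set.Icc 0 x, HasDerivWithinAt u₁ (u₂ t) (Set.Icc 0 x) t) (hM : 0 ≤ M)
    (hL : ∀ a ∈ Set.Icc 0 x, ∀ b ∈ Set.Icc 0 x, |u₂ b - u₂ a| ≤ M * |b - a|)
    {a h t : ℝ} (ha : 0 ≤ a) (hh : 0 < h) (hx : a + h ≤ x) (ht : t ∈ Set.Icc a (a + h)) :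
    |u₁ t - (u (a + h) - u a) / h - u₂ a * (t - a - h / 2)| ≤ 2 * M * h ^ 2 := by
  have h1 := abs_taylor_one_le hu₁ hM hL ha ht.1 (ht.2.trans hx)
  have h2 := abs_taylor_two_le hu hu₁ hM hL ha (by linarith : a ≤ a + h) hx
  rw [add_sub_cancel_left] at h2
  have h3 : |(u (a + h) - u a - u₁ a * h - u₂ a * h ^ 2 / 2) / h| ≤ M * h ^ 2 := by
    rw [abs_div, abs_of_pos hh, div_le_iff₀ hh]
    linarith
  have h4 : M * (t - a) ^ 2 ≤ M * h ^ 2 :=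
    mul_le_mul_of_nonneg_left (pow_le_pow_left₀ (by linarith [ht.1]) (by linarith [ht.2]) 2) hM
  have e : u₁ t - (u (a + h) - u a) / h - u₂ a * (t - a - h / 2) =
      (u₁ t - u₁ a - u₂ a * (t - a)) -
        (u (a + h) - u a - u₁ a * h - u₂ a * h ^ 2 / 2) / h := by
    field_simp
    ring
  rw [e]
  refine (abs_sub _ _).trans ?_
  linarith

lemma abs_second_difference_sub_le
    (hu : ∀ t ∈ Set.Icc 0 x, HasDerivWithinAt u (u₁ t) (Set.Icc 0 x) t)
    (hu₁ : ∀ t ∈ Set.Icc 0 x, HasDerivWithinAt u₁ (u₂ t) (Set.Icc 0 x) t) (hM : 0 ≤ M)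
    (hL : ∀ a ∈ Set.Icc 0 x, ∀ b ∈ Set.Icc 0 x, |u₂ b - u₂ a| ≤ M * |b - a|)
    {h : ℝ} (hh : 0 < h) (hx : 2 * h ≤ x) :
    |(u 0 - 2 * u h + u (2 * h)) - u₂ 0 * h ^ 2| ≤ 10 * M * h ^ 3 := by
  have h1 := abs_taylor_two_le hu hu₁ hM hL le_rfl hh.le (by linarith)
  have h2 := abs_taylor_two_le hu hu₁ hM hL le_rfl (by linarith : 0 ≤ 2 * h) hx
  rw [sub_zero, abs_le] at h1 h2
  rw [abs_le]
  constructor <;> nlinarith [h1.1, h1.2, h2.1, h2.2]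

end Taylor

/-! ### Cell integrals against the kernel -/

lemma integral_rpow_neg_cell {α h : ℝ} (hα : α < 1) (hh : 0 < h) (k : ℕ) :
    ∫ t in (k * h : ℝ)..(k * h + h), t ^ (-α) =
      h ^ (1 - α) / (1 - α) * (((k : ℝ) + 1) ^ (1 - α) - (k : ℝ) ^ (1 - α)) := by
  rw [integral_rpow (Or.inl (by linarith)), show -α + 1 = 1 - α by ring,
    show (k * h + h : ℝ) = ((k : ℝ) + 1) * h by ring, Real.mul_rpow (by positivity) hh.le,
    Real.mul_rpow (by positivity) hh.le]
  ring

lemma integral_sub_mid_mul_rpow_neg_cell {α h : ℝ} (hα : α < 1) (hh : 0 < h) (k : ℕ) :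
    ∫ t in (k * h : ℝ)..(k * h + h), (t - k * h - h / 2) * t ^ (-α) =
      h ^ (2 - α) / (1 - α) * kernelMoment α k := by
  have hk : (0 : ℝ) ≤ k := Nat.cast_nonneg k
  have hi := intervalIntegral.intervalIntegrable_rpow' (a := k * h) (b := k * h + h) (r := -α)
    (by linarith)
  have hi' := intervalIntegral.intervalIntegrable_rpow' (a := k * h) (b := k * h + h) (r := 1 - α)
    (by linarith)
  have e : ∫ t in (k * h : ℝ)..(k * h + h), (t - k * h - h / 2) * t ^ (-α) =
      ∫ t in (k * h : ℝ)..(k * h + h), (t ^ (1 - α) - (k * h + h / 2) * t ^ (-α)) := by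
    refine intervalIntegral.integral_congr fun t ht => ?_
    rw [Set.uIcc_of_le (by linarith)] at ht
    have ht0 : 0 ≤ t := le_trans (by positivity) ht.1
    rw [sub_eq_add_neg 1 α, Real.rpow_one_add' ht0 (by linarith)]
    ring
  rw [e, intervalIntegral.integral_sub hi' (hi.const_mul _),
    intervalIntegral.integral_const_mul, integral_rpow_neg_cell hα hh,
    integral_rpow (Or.inl (by linarith)), show 1 - α + 1 = 2 - α by ring,
    show (k * h + h : ℝ) = ((k : ℝ) + 1) * h by ring, Real.mul_rpow (by positivity) hh.le,
    Real.mul_rpow (by positivity) hh.le, kernelMoment]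
  have hp : ∀ {t : ℝ}, 0 ≤ t → t ^ (2 - α) = t * t ^ (1 - α) := fun ht => by
    rw [show 2 - α = 1 + (1 - α) by ring, Real.rpow_one_add' ht (by linarith)]
  rw [hp (by positivity : (0 : ℝ) ≤ k + 1), hp hk, hp hh.le]
  have h1 : (1 - α) ≠ 0 := by linarith
  have h2 : (2 - α) ≠ 0 := by linarith
  field_simp
  ring

/-! ### The error of the modified L1 sum -/

section Error

variable {u u₁ u₂ : ℝ → ℝ} {x M α h : ℝ}

lemma abs_integral_cell_sub_le
    (hu : ∀ t ∈ Set.Icc 0 x, HasDerivWithinAt u (u₁ t) (Set.Icc 0 x) t)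
    (hu₁ : ∀ t ∈ Set.Icc 0 x, HasDerivWithinAt u₁ (u₂ t) (Set.Icc 0 x) t) (hM : 0 ≤ M)
    (hL : ∀ a ∈ Set.Icc 0 x, ∀ b ∈ Set.Icc 0 x, |u₂ b - u₂ a| ≤ M * |b - a|)
    (hα : α < 1) (hh : 0 < h) {k : ℕ} (hk : k * h + h ≤ x) :
    |(∫ t in (k * h : ℝ)..(k * h + h), u₁ t * t ^ (-α)) -
      h ^ (-α) / (1 - α) * ((u (k * h + h) - u (k * h)) *
        (((k : ℝ) + 1) ^ (1 - α) - (k : ℝ) ^ (1 - α))) -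
      h ^ 2 * (h ^ (-α) / (1 - α)) * (u₂ (k * h) * kernelMoment α k)| ≤
      2 * M * h ^ 2 * ∫ t in (k * h : ℝ)..(k * h + h), t ^ (-α) := by
  have ha : (0 : ℝ) ≤ k * h := by positivity
  have hle : (k * h : ℝ) ≤ k * h + h := by linarith
  have hi := intervalIntegral.intervalIntegrable_rpow' (a := k * h) (b := k * h + h) (r := -α)
    (by linarith)
  have hsub : Set.uIcc (k * h : ℝ) (k * h + h) ⊆ Set.Icc 0 x := by
    rw [Set.uIcc_of_le hle]
    exact Set.Icc_subset_Icc ha hk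
  have hc : ContinuousOn u₁ (Set.uIcc (k * h : ℝ) (k * h + h)) := fun t ht =>
    (hu₁ t (hsub ht)).continuousWithinAt.mono hsub
  have hi₁ := hi.continuousOn_mul hc
  have hi₂ := hi.continuousOn_mul (g := fun t => t - k * h - h / 2) (by fun_prop)
  set D := (u (k * h + h) - u (k * h)) / h with hD
  have hint : (∫ t in (k * h : ℝ)..(k * h + h),
      (u₁ t - D - u₂ (k * h) * (t - k * h - h / 2)) * t ^ (-α)) =
      (∫ t in (k * h : ℝ)..(k * h + h), u₁ t * t ^ (-α)) -
      h ^ (-α) / (1 - α) * ((u (k * h + h) - u (k * h)) *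
        (((k : ℝ) + 1) ^ (1 - α) - (k : ℝ) ^ (1 - α))) -
      h ^ 2 * (h ^ (-α) / (1 - α)) * (u₂ (k * h) * kernelMoment α k) := by
    have e : ∀ t : ℝ, (u₁ t - D - u₂ (k * h) * (t - k * h - h / 2)) * t ^ (-α) =
        u₁ t * t ^ (-α) - D * t ^ (-α) - u₂ (k * h) * ((t - k * h - h / 2) * t ^ (-α)) :=
      fun t => by ring
    simp only [e]
    rw [intervalIntegral.integral_sub (hi₁.sub (hi.const_mul _)) (hi₂.const_mul _),
      intervalIntegral.integral_sub hi₁ (hi.const_mul _),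
      intervalIntegral.integral_const_mul, intervalIntegral.integral_const_mul,
      integral_rpow_neg_cell hα hh, integral_sub_mid_mul_rpow_neg_cell hα hh]
    have e1 : h ^ (1 - α) = h * h ^ (-α) := by
      rw [sub_eq_add_neg, Real.rpow_add hh, Real.rpow_one]
    have e2 : h ^ (2 - α) = h ^ 2 * h ^ (-α) := by
      rw [sub_eq_add_neg, Real.rpow_add hh, Real.rpow_two]
    rw [e1, e2, hD]
    have : (1 - α) ≠ 0 := by linarith
    field_simp
  rw [← hint, ← intervalIntegral.integral_const_mul, ← Real.norm_eq_abs]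
  refine intervalIntegral.norm_integral_le_of_norm_le hle
    (Filter.Eventually.of_forall fun t ht => ?_) (hi.const_mul _)
  have ht0 : 0 ≤ t := ha.trans ht.1.le
  rw [norm_mul, Real.norm_eq_abs, Real.norm_eq_abs, abs_of_nonneg (Real.rpow_nonneg ht0 _)]
  exact mul_le_mul_of_nonneg_right
    (abs_deriv_sub_slope_sub_le hu hu₁ hM hL ha hh hk ⟨ht.1.le, ht.2⟩) (Real.rpow_nonneg ht0 _)

lemma abs_integral_sub_sum_le
    (hu : ∀ t ∈ Set.Icc 0 x, HasDerivWithinAt u (u₁ t) (Set.Icc 0 x) t)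
    (hu₁ : ∀ t ∈ Set.Icc 0 x, HasDerivWithinAt u₁ (u₂ t) (Set.Icc 0 x) t) (hM : 0 ≤ M)
    (hL : ∀ a ∈ Set.Icc 0 x, ∀ b ∈ Set.Icc 0 x, |u₂ b - u₂ a| ≤ M * |b - a|)
    (hα : α < 1) (hh : 0 < h) {n : ℕ} (hn : x = n * h) :
    |(∫ t in (0 : ℝ)..x, u₁ t * t ^ (-α)) -
      h ^ (-α) / (1 - α) * (∑ k ∈ Finset.range n, (u ((k + 1 : ℕ) * h) - u (k * h)) *
        (((k : ℝ) + 1) ^ (1 - α) - (k : ℝ) ^ (1 - α))) -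
      h ^ 2 * (h ^ (-α) / (1 - α)) * ∑ k ∈ Finset.range n, u₂ (k * h) * kernelMoment α k| ≤
      2 * M * h ^ 2 * ∫ t in (0 : ℝ)..x, t ^ (-α) := by
  have hx : 0 ≤ x := by rw [hn]; positivity
  have ek : ∀ k : ℕ, ((k + 1 : ℕ) : ℝ) * h = k * h + h := fun k => by push_cast; ring
  have hk : ∀ k < n, (k : ℝ) * h + h ≤ x := fun k hk => by
    rw [← ek, hn]
    exact mul_le_mul_of_nonneg_right (by exact_mod_cast hk) hh.le
  have hadj : ∀ f : ℝ → ℝ, IntervalIntegrable f MeasureTheory.volume 0 x →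
      ∑ k ∈ Finset.range n, ∫ t in (k * h : ℝ)..(k * h + h), f t = ∫ t in (0 : ℝ)..x, f t := by
    intro f hf
    have h1 := intervalIntegral.sum_integral_adjacent_intervals (f := f)
      (μ := MeasureTheory.volume) (a := fun k : ℕ => (k : ℝ) * h) (n := n) ?_
    · simp only [ek] at h1
      rw [h1, hn]
      simp
    · intro k hkn
      refine hf.mono_set ?_
      simp only [ek]
      rw [Set.uIcc_of_le (by linarith), Set.uIcc_of_le hx]
      exact Set.Icc_subset_Icc (by positivity) (hk k hkn)
  have hi := intervalIntegral.intervalIntegrable_rpow' (a := 0) (b := x) (r := -α) (by linarith)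
  have hc : ContinuousOn u₁ (Set.uIcc 0 x) := by
    rw [Set.uIcc_of_le hx]
    exact fun t ht => (hu₁ t ht).continuousWithinAt
  rw [← hadj _ (hi.continuousOn_mul hc), ← hadj _ hi, Finset.mul_sum, Finset.mul_sum,
    Finset.mul_sum, ← Finset.sum_sub_distrib, ← Finset.sum_sub_distrib]
  refine (Finset.abs_sum_le_sum_abs _ _).trans (Finset.sum_le_sum fun k hkn => ?_)
  rw [ek]
  exact abs_integral_cell_sub_le hu hu₁ hM hL hα hh (hk k (Finset.mem_range.1 hkn))

/-- Freezing `u₂` at the singularity of the kernel and completing the series costs `O(h ^ α)`: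
the moments decay like `k ^ (-α - 1)` while `u₂ (k h) - u₂ 0` grows at most like `k h`. -/
lemma abs_sum_mul_kernelMoment_sub_le
    (hM : 0 ≤ M) (hL : ∀ a ∈ Set.Icc 0 x, ∀ b ∈ Set.Icc 0 x, |u₂ b - u₂ a| ≤ M * |b - a|)
    (hα0 : 0 < α) (hα : α < 1) (hh : 0 < h) {n : ℕ} (hn1 : 1 ≤ n) (hn : x = n * h) :
    |∑ k ∈ Finset.range n, u₂ (k * h) * kernelMoment α k - u₂ 0 * realZeta (α - 1)| ≤
      h ^ α * (M * x ^ (1 - α) / (1 - α) + |u₂ 0| * (4 / α * x ^ (-α))) := by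
  have hx : 0 ≤ x := by rw [hn]; positivity
  have hterm : ∀ k < n, |(u₂ (k * h) - u₂ 0) * kernelMoment α k| ≤ M * h * (k : ℝ) ^ (-α) := by
    intro k hk
    rcases k with _ | k
    · simpa using mul_nonneg (mul_nonneg hM hh.le) (Real.rpow_nonneg le_rfl _)
    rw [abs_mul]
    have hm : ((k + 1 : ℕ) : ℝ) * h ∈ Set.Icc 0 x := by
      refine ⟨by positivity, ?_⟩
      rw [hn]
      exact mul_le_mul_of_nonneg_right (by exact_mod_cast hk.le) hh.le
    have h1 := hL 0 ⟨le_rfl, hx⟩ _ hm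
    rw [sub_zero, abs_of_nonneg hm.1] at h1
    have h2 := abs_kernelMoment_succ_le hα0 hα k
    have hk0 : (0 : ℝ) < (k : ℝ) + 1 := by positivity
    refine (mul_le_mul h1 h2 (abs_nonneg _) (by positivity)).trans (le_of_eq ?_)
    push_cast
    rw [Real.rpow_sub_one hk0.ne']
    field_simp
  have hsum : |∑ k ∈ Finset.range n, (u₂ (k * h) - u₂ 0) * kernelMoment α k| ≤
      M * h * ((n : ℝ) ^ (1 - α) / (1 - α)) := by
    refine (Finset.abs_sum_le_sum_abs _ _).trans ((Finset.sum_le_sum fun k hk =>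
      hterm k (Finset.mem_range.1 hk)).trans ?_)
    rw [← Finset.mul_sum]
    refine mul_le_mul_of_nonneg_left ?_ (by positivity)
    refine le_trans ?_ (sum_add_one_rpow_neg_le hα0 hα n)
    have h0 : ((0 : ℕ) : ℝ) ^ (-α) = 0 := by
      rw [Nat.cast_zero, Real.zero_rpow (by linarith)]
    calc ∑ k ∈ Finset.range n, (k : ℝ) ^ (-α)
        ≤ ∑ k ∈ Finset.range (n + 1), (k : ℝ) ^ (-α) := by
          rw [Finset.sum_range_succ]
          linarith [Real.rpow_nonneg (Nat.cast_nonneg (α := ℝ) n) (-α)]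
      _ = ∑ k ∈ Finset.range n, ((k : ℝ) + 1) ^ (-α) := by
          rw [Finset.sum_range_succ', h0, add_zero]
          push_cast
          rfl
  have htail := mul_le_mul_of_nonneg_left (abs_sum_kernelMoment_sub_le hα0 hα hn1)
    (abs_nonneg (u₂ 0))
  rw [← abs_mul] at htail
  have e : ∑ k ∈ Finset.range n, u₂ (k * h) * kernelMoment α k - u₂ 0 * realZeta (α - 1) =
      ∑ k ∈ Finset.range n, (u₂ (k * h) - u₂ 0) * kernelMoment α k +
        u₂ 0 * (∑ k ∈ Finset.range n, kernelMoment α k - realZeta (α - 1)) := by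
    simp only [sub_mul, Finset.sum_sub_distrib, ← Finset.mul_sum]
    ring
  rw [e]
  refine (abs_add_le _ _).trans ((add_le_add hsum htail).trans (le_of_eq ?_))
  have hn0 : (0 : ℝ) ≤ n := Nat.cast_nonneg n
  have e1 : h ^ α * h ^ (1 - α) = h := by
    rw [← Real.rpow_add hh, add_sub_cancel, Real.rpow_one]
  have e2 : h ^ α * h ^ (-α) = 1 := by
    rw [← Real.rpow_add hh, add_neg_cancel, Real.rpow_zero]
  rw [hn, Real.mul_rpow hn0 hh.le, Real.mul_rpow hn0 hh.le]
  linear_combination (-(M * (n : ℝ) ^ (1 - α) / (1 - α))) * e1 -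
    (|u₂ 0| * (4 / α * (n : ℝ) ^ (-α))) * e2

/-- The modified L1 sum approximates the singular integral of `u₁ = u'` with second order. -/
lemma exists_abs_integral_sub_le
    (hu : ∀ t ∈ Set.Icc 0 x, HasDerivWithinAt u (u₁ t) (Set.Icc 0 x) t)
    (hu₁ : ∀ t ∈ Set.Icc 0 x, HasDerivWithinAt u₁ (u₂ t) (Set.Icc 0 x) t) (hM : 0 ≤ M)
    (hL : ∀ a ∈ Set.Icc 0 x, ∀ b ∈ Set.Icc 0 x, |u₂ b - u₂ a| ≤ M * |b - a|)
    (hα0 : 0 < α) (hα : α < 1) :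
    ∃ C : ℝ, ∀ (n : ℕ) (h : ℝ), 2 ≤ n → 0 < h → x = n * h →
      |(∫ t in (0 : ℝ)..x, u₁ t * t ^ (-α)) -
        h ^ (-α) / (1 - α) * (∑ k ∈ Finset.range n, (u ((k + 1 : ℕ) * h) - u (k * h)) *
          (((k : ℝ) + 1) ^ (1 - α) - (k : ℝ) ^ (1 - α)) +
          realZeta (α - 1) * (u 0 - 2 * u h + u (2 * h)))| ≤ C * h ^ 2 := by
  refine ⟨2 * M * (∫ t in (0 : ℝ)..x, t ^ (-α)) +
    (M * x ^ (1 - α) / (1 - α) + |u₂ 0| * (4 / α * x ^ (-α))) / (1 - α) +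
    |realZeta (α - 1)| * (10 * M * x ^ (1 - α)) / (1 - α), fun n h hn2 hh hn => ?_⟩
  have h2x : 2 * h ≤ x := by
    rw [hn]
    exact mul_le_mul_of_nonneg_right (by exact_mod_cast hn2) hh.le
  have hα' : 0 < 1 - α := by linarith
  have hA := abs_integral_sub_sum_le hu hu₁ hM hL hα hh hn
  have hW := abs_sum_mul_kernelMoment_sub_le hM hL hα0 hα hh (by omega) hn
  have hΔ := abs_second_difference_sub_le hu hu₁ hM hL hh h2x
  set T := ∫ t in (0 : ℝ)..x, u₁ t * t ^ (-α)
  set S := ∑ k ∈ Finset.range n, (u ((k + 1 : ℕ) * h) - u (k * h)) *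
          (((k : ℝ) + 1) ^ (1 - α) - (k : ℝ) ^ (1 - α))
  set W := ∑ k ∈ Finset.range n, u₂ (k * h) * kernelMoment α k
  set Z := realZeta (α - 1)
  set Δ := u 0 - 2 * u h + u (2 * h)
  set P := h ^ (-α) / (1 - α) with hP
  set B := M * x ^ (1 - α) / (1 - α) + |u₂ 0| * (4 / α * x ^ (-α))
  have hP0 : 0 ≤ P := by positivity
  have e1 : P * h ^ α = 1 / (1 - α) := by
    rw [hP, div_mul_eq_mul_div, ← Real.rpow_add hh, neg_add_cancel, Real.rpow_zero]
  have e2 : P * h = h ^ (1 - α) / (1 - α) := by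
    rw [hP, div_mul_eq_mul_div, sub_eq_add_neg 1 α, Real.rpow_add hh, Real.rpow_one]
    ring
  have hW' : |h ^ 2 * P * (W - u₂ 0 * Z)| ≤ h ^ 2 * (B / (1 - α)) := by
    rw [abs_mul, abs_of_nonneg (by positivity : 0 ≤ h ^ 2 * P)]
    refine (mul_le_mul_of_nonneg_left hW (by positivity)).trans (le_of_eq ?_)
    linear_combination (h ^ 2 * B) * e1
  have hΔ' : |P * Z * (Δ - u₂ 0 * h ^ 2)| ≤ h ^ 2 * (|Z| * (10 * M * x ^ (1 - α)) / (1 - α)) := by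
    rw [abs_mul, abs_mul, abs_of_nonneg hP0]
    refine (mul_le_mul_of_nonneg_left hΔ (by positivity)).trans ?_
    have e3 : P * |Z| * (10 * M * h ^ 3) = h ^ 2 * (|Z| * (10 * M * h ^ (1 - α)) / (1 - α)) := by
      linear_combination (|Z| * 10 * M * h ^ 2) * e2
    rw [e3]
    have : h ^ (1 - α) ≤ x ^ (1 - α) := Real.rpow_le_rpow hh.le (by linarith) hα'.le
    gcongr
  have e : T - P * (S + Z * Δ) = (T - P * S - h ^ 2 * P * W) + h ^ 2 * P * (W - u₂ 0 * Z) -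
      P * Z * (Δ - u₂ 0 * h ^ 2) := by ring
  rw [e]
  refine (abs_sub _ _).trans ?_
  have := abs_add_le (T - P * S - h ^ 2 * P * W) (h ^ 2 * P * (W - u₂ 0 * Z))
  linarith

end Error

/-! ### Reflection to the distance from the endpoint -/

lemma exists_lipschitz_second_deriv {u : ℝ → ℝ} {x : ℝ} (hx : 0 < x)
    (hu : ContDiffOn ℝ 3 u (Set.Icc 0 x)) :
    ∃ (u₂ : ℝ → ℝ) (M : ℝ), 0 ≤ M ∧
      (∀ t ∈ Set.Icc 0 x, HasDerivWithinAt (derivWithin u (Set.Icc 0 x)) (u₂ t) (Set.Icc 0 x) t) ∧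
      ∀ a ∈ Set.Icc 0 x, ∀ b ∈ Set.Icc 0 x, |u₂ b - u₂ a| ≤ M * |b - a| := by
  have hU : UniqueDiffOn ℝ (Set.Icc 0 x) := uniqueDiffOn_Icc hx
  have h1 : ContDiffOn ℝ 2 (derivWithin u (Set.Icc 0 x)) (Set.Icc 0 x) :=
    hu.derivWithin hU (by norm_num)
  have h2 : ContDiffOn ℝ 1 (derivWithin (derivWithin u (Set.Icc 0 x)) (Set.Icc 0 x))
      (Set.Icc 0 x) := h1.derivWithin hU (by norm_num)
  obtain ⟨M, hM⟩ := isCompact_Icc.exists_bound_of_continuousOn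
    (h2.continuousOn_derivWithin hU le_rfl)
  refine ⟨derivWithin (derivWithin u (Set.Icc 0 x)) (Set.Icc 0 x), M,
    (norm_nonneg _).trans (hM 0 ⟨le_rfl, hx.le⟩),
    fun t ht => (h1.differentiableOn (by norm_num) t ht).hasDerivWithinAt, fun a ha b hb => ?_⟩
  exact (convex_Icc 0 x).norm_image_sub_le_of_norm_hasDerivWithin_le
    (fun t ht => (h2.differentiableOn (by norm_num) t ht).hasDerivWithinAt) hM ha hb

lemma caputoDeriv_eq_integral_reflect {α x : ℝ} {y : ℝ → ℝ} (hx : 0 < x)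
    (hy : DifferentiableOn ℝ y (Set.Icc 0 x)) :
    caputoDeriv α y x = -(1 / Real.Gamma (1 - α) *
      ∫ t in (0 : ℝ)..x, derivWithin (fun t => y (x - t)) (Set.Icc 0 x) t * t ^ (-α)) := by
  have h := intervalIntegral.integral_comp_sub_left (a := 0) (b := x)
    (fun ξ => deriv y ξ / (x - ξ) ^ α) x
  rw [sub_self, sub_zero] at h
  rw [caputoDeriv, ← h, ← mul_neg, ← intervalIntegral.integral_neg]
  congr 1
  -- The two-sided derivative is only controlled in the open interval.
  refine intervalIntegral.integral_congr_uIoo fun t ht => ?_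
  rw [Set.uIoo_of_le hx.le] at ht
  have hd : DifferentiableAt ℝ y (x - t) :=
    (hy (x - t) ⟨by linarith [ht.2], by linarith [ht.1]⟩).differentiableAt
      (Icc_mem_nhds (by linarith [ht.2]) (by linarith [ht.1]))
  have h1 : HasDerivAt (fun t => y (x - t)) (deriv y (x - t) * (-1)) t :=
    hd.hasDerivAt.comp t (by simpa using (hasDerivAt_id t).const_sub x)
  rw [h1.hasDerivWithinAt.derivWithin (uniqueDiffOn_Icc hx t ⟨ht.1.le, ht.2.le⟩),
    Real.rpow_neg ht.1.le, sub_sub_cancel, div_eq_mul_inv]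
  ring

theorem theorem8 (α : ℝ) (hα0 : 0 < α) (hα1 : α < 1) (x : ℝ) (hx : 0 < x)
    (y : ℝ → ℝ) (hy : ContDiffOn ℝ 3 y (Set.Icc 0 x)) :
    ∃ C : ℝ, ∀ (n : ℕ) (h : ℝ), 2 ≤ n → 0 < h → x = (n : ℝ) * h →
      |caputoDeriv α y x - modifiedL1 α y x h n| ≤ C * h ^ 2 := by
  have hu : ContDiffOn ℝ 3 (fun t => y (x - t)) (Set.Icc 0 x) :=
    hy.comp (by fun_prop) fun t ht => ⟨by linarith [ht.2], by linarith [ht.1]⟩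
  obtain ⟨u₂, M, hM, hu₁, hL⟩ := exists_lipschitz_second_deriv hx hu
  obtain ⟨C, hC⟩ := exists_abs_integral_sub_le
    (fun t ht => (hu.differentiableOn (by norm_num) t ht).hasDerivWithinAt) hu₁ hM hL hα0 hα1
  have hG : 0 < Real.Gamma (1 - α) := Real.Gamma_pos_of_pos (by linarith)
  refine ⟨1 / Real.Gamma (1 - α) * C, fun n h hn2 hh hn => ?_⟩
  have hΓ : Real.Gamma (2 - α) = (1 - α) * Real.Gamma (1 - α) := by
    rw [← Real.Gamma_add_one (by linarith)]
    congr 1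
    ring
  have hmod : modifiedL1 α y x h n = -(1 / Real.Gamma (1 - α) * (h ^ (-α) / (1 - α) *
      (∑ k ∈ Finset.range n, (y (x - (k + 1 : ℕ) * h) - y (x - k * h)) *
          (((k : ℝ) + 1) ^ (1 - α) - (k : ℝ) ^ (1 - α)) +
          realZeta (α - 1) * (y (x - 0) - 2 * y (x - h) + y (x - 2 * h))))) := by
    rw [modifiedL1, sum_modifiedL1Weight_mul hα1 hn2 (fun k => y (x - k * h)), hΓ,
      Real.rpow_neg hh.le]
    have h1 : (1 - α) ≠ 0 := by linarith
    have h2 : h ^ α ≠ 0 := (Real.rpow_pos_of_pos hh α).ne'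
    have e : 1 / ((1 - α) * Real.Gamma (1 - α) * h ^ α) =
        1 / Real.Gamma (1 - α) * ((h ^ α)⁻¹ / (1 - α)) := by field_simp
    simp only [Nat.cast_zero, zero_mul, Nat.cast_one, one_mul, Nat.cast_ofNat]
    rw [e, mul_neg, mul_assoc]
  rw [caputoDeriv_eq_integral_reflect hx (hy.differentiableOn (by norm_num)), hmod, neg_sub_neg,
    ← mul_sub, abs_mul, abs_of_pos (by positivity), abs_sub_comm, mul_assoc]
  exact mul_le_mul_of_nonneg_left (hC n h hn2 hh hn) (by positivity)
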